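/- **Theorem 8.1.** Let $G_n$ be the toroidal $n\times n$ grid: its nodes are the pairs $(x,y)$ of integers modulo $n$, two distinct nodes are adjacent if they differ by $\pm 1$ (modulo $n$) in exactly one coordinate and agree in the other, and every node knows which of its incident edges leads north ($y+1$), east ($x+1$), south ($y-1$) and west ($x-1$). Consider deterministic algorithms in the LOCAL model: all nodes run the same algorithm; each node initially knows only $n$ and its own identifier, the identifiers being pairwise distinct elements of $\{1,\dots,N\}$; in each synchronous round every node sends a message of arbitrary size to each of its neighbours, receives their messages and updates its state by an arbitrary computation; after some number of rounds it stops and announces its output. An algorithm solves vertex $3$-colouring on $G_n$ in $T$ rounds if, for every assignment of identifiers, all nodes have stopped after $T$ rounds and their outputs form a proper vertex colouring of $G_n$ with $3$ colours. Vertex $3$-colouring of oriented toroidal $2$-dimensional $n\times n$ grids requires $\Omega(n)$ rounds in the LOCAL model. That is, there are constants $c>0$ and $n_0$ such that for all $n\ge n_0$ and all $N\ge n^2$ (in particular for every identifier space $\{1,\dots,\mathrm{poly}(n)\}$ that has room for $n^2$ distinct identifiers), every algorithm that solves vertex $3$-colouring on $G_n$ with identifiers from $\{1,\dots,N\}$ in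 $T$ rounds satisfies $T\ge c\,n$. -/

import Mathlib

universe u v

/-- The four port labels of a node of the consistently oriented grid. -/
inductive Dir where
  | north
  | east
  | south
  | west

/-- The label, at the other endpoint, of an edge labelled `d` at this endpoint. -/
def Dir.opp : Dir → Dir
  | .north => .south
  | .east => .west
  | .south => .north
  | .west => .east

/-- The nodes `(x, y)` of the toroidal `n × n` grid, with coordinates modulo `n` (for `n ≥ 1`). -/
abbrev Node (n : ℕ) : Type := ZMod n × ZMod n

/-- The neighbour of a node in a given direction: north and south change the `y` coordinate
by `1` and `-1`, east and west the `x` coordinate. -/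
def Node.nbr {n : ℕ} (p : Node n) : Dir → Node n
  | .north => (p.1, p.2 + 1)
  | .east => (p.1 + 1, p.2)
  | .south => (p.1, p.2 - 1)
  | .west => (p.1 - 1, p.2)

theorem Node.nbr_opp {n : ℕ} (p : Node n) (d : Dir) : (p.nbr d).nbr d.opp = p := by
  cases d <;> simp [Node.nbr, Dir.opp]

/-- The toroidal `n × n` grid as a graph (self-loops, which could arise only for `n = 1`,
are left out). -/
def toroidalGrid (n : ℕ) : SimpleGraph (Node n) where
  Adj p q := p ≠ q ∧ ∃ d : Dir, q = p.nbr d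
  symm := ⟨by
    rintro p q ⟨hne, d, rfl⟩
    exact ⟨hne.symm, d.opp, (p.nbr_opp d).symm⟩⟩
  loopless := ⟨fun _ h => h.1 rfl⟩

/-- A deterministic algorithm with outputs in `X` in the LOCAL model on oriented grids.
All nodes run the same algorithm. States and messages are arbitrary (unbounded size), and local
computation is unrestricted. A node starts with the value of `n` and its own identifier.
A node with `output s = none` has not yet stopped; once announced, an output never changes. -/
structure LocalAlgorithm (X : Type) where
  /-- local states of a node -/
  State : Type u
  /-- messages -/
  Msg : Type v
  /-- the initial state, from the value of `n` and the node's identifier -/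
  init : (n : ℕ) → (ident : ℕ) → State
  /-- the message sent through each of the four ports -/
  send : State → Dir → Msg
  /-- the new state, from the old one and the messages received through the four ports -/
  recv : State → (Dir → Msg) → State
  /-- the announced output, if any -/
  output : State → Option X
  output_stable : ∀ (s : State) (m : Dir → Msg) (x : X),
    output s = some x → output (recv s m) = some x

/-- The state of each node after `t` synchronous communication rounds on the toroidal `n × n` grid
with identifiers `ident`. In every round the message that arrives through the port `d` of `p` is
the one that the neighbour of `p` in direction `d` sent through its opposite port. -/
def LocalAlgorithm.stateAfter {X : Type} (A : LocalAlgorithm.{u, v} X) {n : ℕ}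
    (ident : Node n → ℕ) : ℕ → Node n → A.State
  | 0, p => A.init n (ident p)
  | t + 1, p => A.recv (A.stateAfter ident t p)
      (fun d => A.send (A.stateAfter ident t (p.nbr d)) d.opp)

/-- An assignment of unique identifiers from `{1, …, N}`. -/
def IsIdentAssignment {n : ℕ} (N : ℕ) (ident : Node n → ℕ) : Prop :=
  Function.Injective ident ∧ ∀ p, ident p ∈ Set.Icc 1 N

/-- On toroidal `n × n` grids with unique identifiers from `{1, …, N}`, the algorithm `A` solves
vertex 3-colouring in (at most) `T` rounds: for every assignment of identifiers, after `T` rounds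
all nodes have stopped and their outputs form a proper vertex 3-colouring. -/
def LocalAlgorithm.ThreeColoursIn (A : LocalAlgorithm.{u, v} (Fin 3)) (n N T : ℕ) : Prop :=
  ∀ ident : Node n → ℕ, IsIdentAssignment N ident →
    ∃ f : (toroidalGrid n).Coloring (Fin 3), ∀ p, A.output (A.stateAfter ident T p) = some (f p)

/-!
The local rule that an algorithm follows on the `n × n` torus makes sense on the infinite grid
`ℤ × ℤ` as well, for any labelling by numbers from `{1, …, n ^ 2}` in place of the identifiers.
If the labels are distinct within every box of side `2 * T + 3`, then two neighbouring nodes see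
together only what they could also see on a torus with unique identifiers, so the rule still
produces a proper 3-colouring (`LocalAlgorithm.exists_gridOutput_ne`). Since labels may be
repeated at a distance, they can be chosen periodic: with horizontal period `a = 6 * T + 6` below
the line `y = 0` and with horizontal period `b = 6 * T + 7` above it (`twoPeriodLabel`). If `T` is
small compared to `n`, there are enough labels for this. The resulting 3-colouring of the infinite
grid has one row of period `a` and one row of period `b`.

No such colouring exists (`false_of_proper_of_periodic_rows`). Call a step from colour `c` to colour
`c + 1` an ascent `+1`, and a step from `c` to `c - 1` a descent `-1`. The steps around a unit
square add up to an even multiple of `3` of absolute value at most `4`, that is, to zero. So the sums along two rows at a fixed distance differ by a bounded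
amount, however long the rows are. If the sums over one period are `w` and `w'`, comparison
over `k * a * b` steps for large `k` gives `b * w = a * w'`, hence `b ∣ w'` as `a` and `b` are
coprime. Now `w'` is odd because `b` is, and `|w'| ≤ b`, so `|w'| = b`; but the colours return after a
period, so `3 ∣ w'`, whereas `3 ∤ 6 * T + 7`.
-/

/-! ### Ascents and descents of 3-colourings -/

/-- The step between two different colours, `+1` for an ascent `c, c + 1` modulo `3` and `-1` for a
descent `c, c - 1`. For equal colours it has the meaningless value `-1`. -/
def colourStep (c d : Fin 3) : ℤ := if d = c + 1 then 1 else -1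

theorem abs_colourStep (c d : Fin 3) : |colourStep c d| = 1 := by
  unfold colourStep; split_ifs <;> simp

theorem three_dvd_sub_colourStep :
    ∀ c d : Fin 3, c ≠ d → (3 : ℤ) ∣ (d.val : ℤ) - c.val - colourStep c d := by
  decide

/-- Steps add up to the same amount along the two ways around a properly coloured unit square. -/
theorem colourStep_add_colourStep : ∀ c d c' d' : Fin 3, c ≠ d → c' ≠ d' → c ≠ c' → d ≠ d' →
    colourStep c d + colourStep d d' = colourStep c c' + colourStep c' d' := by
  decide

/-- The net ascent of a coloured row between the positions `0` and `m`. -/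
def rowSum (f : ℤ → Fin 3) (m : ℕ) : ℤ :=
  ∑ i ∈ Finset.range m, colourStep (f i) (f (i + 1))

theorem rowSum_succ (f : ℤ → Fin 3) (m : ℕ) :
    rowSum f (m + 1) = rowSum f m + colourStep (f m) (f (m + 1)) :=
  Finset.sum_range_succ _ _

theorem abs_rowSum_le (f : ℤ → Fin 3) (m : ℕ) : |rowSum f m| ≤ m := by
  refine (Finset.abs_sum_le_sum_abs _ _).trans ?_
  simp [abs_colourStep]

theorem two_dvd_rowSum_sub (f : ℤ → Fin 3) (m : ℕ) : (2 : ℤ) ∣ rowSum f m - m := by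
  induction m with
  | zero => simp [rowSum]
  | succ m ih =>
    rw [rowSum_succ]
    have := eq_or_eq_neg_of_abs_eq (abs_colourStep (f m) (f (m + 1)))
    push_cast
    omega

theorem three_dvd_sub_rowSum {f : ℤ → Fin 3} (hf : ∀ x, f x ≠ f (x + 1)) (m : ℕ) :
    (3 : ℤ) ∣ ((f m).val : ℤ) - (f 0).val - rowSum f m := by
  induction m with
  | zero => simp [rowSum]
  | succ m ih =>
    rw [rowSum_succ]
    have := three_dvd_sub_colourStep _ _ (hf m)
    push_cast
    omega

theorem rowSum_mul_of_periodic {f : ℤ → Fin 3} {a : ℕ} (hf : ∀ x, f (x + a) = f x) (k : ℕ) :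
    rowSum f (k * a) = k * rowSum f a := by
  have hk : ∀ k : ℕ, ∀ x, f (((k * a : ℕ) : ℤ) + x) = f x := by
    intro k
    induction k with
    | zero => simp
    | succ k ih =>
      intro x
      rw [← ih x, ← hf (((k * a : ℕ) : ℤ) + x)]
      congr 1
      push_cast
      ring
  induction k with
  | zero => simp [rowSum]
  | succ k ih =>
    have h : rowSum f ((k + 1) * a) = rowSum f (k * a) + rowSum f a := by
      rw [add_mul, one_mul, rowSum, Finset.sum_range_add]
      refine congrArg (rowSum f (k * a) + ·) (Finset.sum_congr rfl fun i _ => ?_)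
      rw [Nat.cast_add, add_assoc, hk, hk]
    rw [h, ih]
    push_cast
    ring

theorem rowSum_sub_rowSum {f g : ℤ → Fin 3} (hf : ∀ x, f x ≠ f (x + 1))
    (hg : ∀ x, g x ≠ g (x + 1)) (hfg : ∀ x, f x ≠ g x) (m : ℕ) :
    rowSum g m - rowSum f m = colourStep (f m) (g m) - colourStep (f 0) (g 0) := by
  induction m with
  | zero => simp [rowSum]
  | succ m ih =>
    rw [rowSum_succ, rowSum_succ]
    have := colourStep_add_colourStep _ _ _ _ (hf m) (hg m) (hfg m) (hfg (m + 1))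
    push_cast
    linarith

/-- The net ascents of two rows at distance `j` differ by at most `2 * j`, whatever the length. -/
theorem abs_rowSum_sub_rowSum_le {col : ℤ → ℤ → Fin 3} (hx : ∀ y x, col y x ≠ col y (x + 1))
    (hy : ∀ y x, col y x ≠ col (y + 1) x) (y : ℤ) (j m : ℕ) :
    |rowSum (col (y + j)) m - rowSum (col y) m| ≤ 2 * j := by
  induction j with
  | zero => simp
  | succ j ih =>
    have h := rowSum_sub_rowSum (hx (y + j)) (hx (y + j + 1)) (hy (y + j)) m
    have h₁ := abs_colourStep (col (y + j) m) (col (y + j + 1) m)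
    have h₂ := abs_colourStep (col (y + j) 0) (col (y + j + 1) 0)
    have e : y + ((j + 1 : ℕ) : ℤ) = y + j + 1 := by push_cast; ring
    rw [e]
    push_cast
    rw [abs_le] at ih ⊢
    have h₁' := abs_le.1 h₁.le
    have h₂' := abs_le.1 h₂.le
    constructor <;> linarith [ih.1, ih.2, h₁'.1, h₁'.2, h₂'.1, h₂'.2]

/-- A proper 3-colouring of the infinite grid (`col y x` is the colour of `(x, y)`) cannot have rows
of two coprime periods, one of which is divisible neither by `2` nor by `3`. -/
theorem false_of_proper_of_periodic_rows {col : ℤ → ℤ → Fin 3}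
    (hx : ∀ y x, col y x ≠ col y (x + 1)) (hy : ∀ y x, col y x ≠ col (y + 1) x)
    {a b : ℕ} (hab : Nat.Coprime a b) (hb₂ : ¬ 2 ∣ b) (hb₃ : ¬ 3 ∣ b) (y : ℤ) (j : ℕ)
    (ha : ∀ x, col y (x + a) = col y x) (hb : ∀ x, col (y + j) (x + b) = col (y + j) x) :
    False := by
  set w := rowSum (col y) a
  set w' := rowSum (col (y + j)) b with hw'
  have key : (a : ℤ) * w' - b * w = 0 := by
    by_contra hne
    have h := abs_rowSum_sub_rowSum_le hx hy y j ((2 * j + 1) * a * b)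
    rw [rowSum_mul_of_periodic hb, mul_right_comm, rowSum_mul_of_periodic ha] at h
    have e : (((2 * j + 1) * a : ℕ) : ℤ) * w' - (((2 * j + 1) * b : ℕ) : ℤ) * w
        = (2 * j + 1) * (a * w' - b * w) := by
      push_cast
      ring
    rw [e, abs_mul, abs_of_nonneg (by positivity)] at h
    have := Int.one_le_abs hne
    nlinarith
  have hdvd : (b : ℤ) ∣ w' :=
    (Nat.isCoprime_iff_coprime.2 hab.symm).dvd_of_dvd_mul_left ⟨w, by linarith⟩
  have h2 := two_dvd_rowSum_sub (col (y + j)) b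
  have h3 := three_dvd_sub_rowSum (hx (y + j)) b
  have hper := hb 0
  rw [zero_add] at hper
  rw [hper] at h3
  have hle := abs_rowSum_le (col (y + j)) b
  rw [← hw'] at h2 h3 hle
  have hne : w' ≠ 0 := by omega
  have hge := Int.le_of_dvd (abs_pos.2 hne) ((dvd_abs _ _).2 hdvd)
  rcases eq_or_eq_neg_of_abs_eq (le_antisymm hle hge) with h | h <;> omega

/-! ### Running an algorithm on the infinite grid -/

/-- The neighbour of a node of the infinite grid in a given direction. -/
def gridNbr (p : ℤ × ℤ) : Dir → ℤ × ℤ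
  | .north => (p.1, p.2 + 1)
  | .east => (p.1 + 1, p.2)
  | .south => (p.1, p.2 - 1)
  | .west => (p.1 - 1, p.2)

/-- The box of radius `r` around `p`, that is, the closed ball of the maximum norm. -/
noncomputable def gridBox (p : ℤ × ℤ) (r : ℕ) : Finset (ℤ × ℤ) :=
  Finset.Icc (p.1 - r) (p.1 + r) ×ˢ Finset.Icc (p.2 - r) (p.2 + r)

theorem mem_gridBox {p q : ℤ × ℤ} {r : ℕ} : q ∈ gridBox p r ↔
    (p.1 - r ≤ q.1 ∧ q.1 ≤ p.1 + r) ∧ p.2 - r ≤ q.2 ∧ q.2 ≤ p.2 + r := by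
  simp [gridBox]

theorem gridBox_mono (p : ℤ × ℤ) {r s : ℕ} (h : r ≤ s) : gridBox p r ⊆ gridBox p s := by
  intro q hq
  rw [mem_gridBox] at hq ⊢
  omega

theorem gridBox_gridNbr_subset (p : ℤ × ℤ) (d : Dir) (r : ℕ) :
    gridBox (gridNbr p d) r ⊆ gridBox p (r + 1) := by
  intro q hq
  rw [mem_gridBox] at hq ⊢
  cases d <;> simp only [gridNbr] at hq <;> push_cast <;> omega

/-- The reduction of the infinite grid modulo `n`. -/
def toTorus (n : ℕ) (p : ℤ × ℤ) : Node n := (p.1, p.2)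

theorem toTorus_gridNbr (n : ℕ) (p : ℤ × ℤ) (d : Dir) :
    toTorus n (gridNbr p d) = (toTorus n p).nbr d := by
  cases d <;> simp [toTorus, gridNbr, Node.nbr]

theorem injOn_toTorus_gridBox {n r : ℕ} (h : 2 * r + 1 ≤ n) (p : ℤ × ℤ) :
    Set.InjOn (toTorus n) (gridBox p r) := by
  have aux : ∀ u x y : ℤ, u - r ≤ x ∧ x ≤ u + r → u - r ≤ y ∧ y ≤ u + r →
      (x : ZMod n) = y → x = y := by
    intro u x y hx hy hxy
    have hdvd := (ZMod.intCast_eq_intCast_iff_dvd_sub x y n).1 hxy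
    have := Int.eq_zero_of_abs_lt_dvd hdvd (by rw [abs_lt]; omega)
    omega
  intro q hq q' hq' hqq
  rw [Finset.mem_coe, mem_gridBox] at hq hq'
  obtain ⟨h₁, h₂⟩ := Prod.ext_iff.1 hqq
  exact Prod.ext (aux p.1 _ _ hq.1 hq'.1 h₁) (aux p.2 _ _ hq.2 hq'.2 h₂)

namespace LocalAlgorithm

variable {X : Type}

/-- The state of each node of the infinite grid, labelled by `L`, after `t` rounds, where all nodes
start as on the `n × n` torus. -/
def gridState (A : LocalAlgorithm.{u, v} X) (n : ℕ) (L : ℤ × ℤ → ℕ) : ℕ → ℤ × ℤ → A.State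
  | 0, p => A.init n (L p)
  | t + 1, p => A.recv (A.gridState n L t p)
      (fun d => A.send (A.gridState n L t (gridNbr p d)) d.opp)

/-- After `t` rounds a node has the same state on the infinite grid and on the torus if the labels
agree up to distance `t`. -/
theorem stateAfter_toTorus (A : LocalAlgorithm.{u, v} X) {n : ℕ} {L : ℤ × ℤ → ℕ}
    {ident : Node n → ℕ} (t : ℕ) (p : ℤ × ℤ)
    (h : ∀ q ∈ gridBox p t, ident (toTorus n q) = L q) :
    A.stateAfter ident t (toTorus n p) = A.gridState n L t p := by
  induction t generalizing p with
  | zero => simp only [stateAfter, gridState, h p (by simp [mem_gridBox])]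
  | succ t ih =>
    simp only [stateAfter, gridState]
    rw [ih p fun q hq => h q (gridBox_mono p t.le_succ hq)]
    congr 1
    funext d
    rw [← toTorus_gridNbr, ih _ fun q hq => h q (gridBox_gridNbr_subset p d t hq)]

/-- After `t` rounds a node and its translate by `(a, 0)` have the same state if the labels up to
distance `t` are the same. -/
theorem gridState_translate (A : LocalAlgorithm.{u, v} X) (n : ℕ) {L : ℤ × ℤ → ℕ} (a : ℤ)
    (t : ℕ) (p : ℤ × ℤ) (h : ∀ q ∈ gridBox p t, L (q.1 + a, q.2) = L q) :
    A.gridState n L t (p.1 + a, p.2) = A.gridState n L t p := by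
  induction t generalizing p with
  | zero => simp only [gridState, h p (by simp [mem_gridBox])]
  | succ t ih =>
    simp only [gridState]
    rw [ih p fun q hq => h q (gridBox_mono p t.le_succ hq)]
    congr 1
    funext d
    have e : gridNbr (p.1 + a, p.2) d = ((gridNbr p d).1 + a, (gridNbr p d).2) := by
      cases d <;> simp only [gridNbr, Prod.mk.injEq, and_true] <;> ring
    rw [e, ih _ fun q hq => h q (gridBox_gridNbr_subset p d t hq)]

/-- If the labels up to distance `T + 1` from `p` are distinct, then the algorithm outputs different colours at `p` and
at a neighbour of `p`. -/
theorem exists_gridOutput_ne {A : LocalAlgorithm.{u, v} (Fin 3)} {n N T : ℕ}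
    (hA : A.ThreeColoursIn n N T) (hN : n ^ 2 ≤ N) (hn : 2 * T + 3 ≤ n) {L : ℤ × ℤ → ℕ}
    (hL : ∀ q, L q ∈ Finset.Icc 1 (n ^ 2)) (p : ℤ × ℤ)
    (hinj : Set.InjOn L (gridBox p (T + 1))) (d : Dir) :
    ∃ c c' : Fin 3, A.output (A.gridState n L T p) = some c ∧
      A.output (A.gridState n L T (gridNbr p d)) = some c' ∧ c ≠ c' := by
  classical
  have : NeZero n := ⟨by omega⟩
  have hproj := injOn_toTorus_gridBox (n := n) (r := T + 1) (by omega) p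
  -- On the image of the box in the torus, `M` is the labelling transported from the grid.
  let M : Node n → ℕ := fun v => L (Function.invFunOn (toTorus n) (gridBox p (T + 1)) v)
  have hM : ∀ q ∈ gridBox p (T + 1), M (toTorus n q) = L q := fun q hq =>
    congrArg L (hproj.leftInvOn_invFunOn hq)
  obtain ⟨g, hg⟩ := Finset.exists_equiv_extend_of_card_eq (t := Finset.Icc 1 (n ^ 2)) (f := M)
    (s := (gridBox p (T + 1)).image (toTorus n)) (by simp [ZMod.card, sq])
    (by
      intro v hv
      obtain ⟨w, -, rfl⟩ := Finset.mem_image.1 hv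
      exact hL _)
    (by
      intro v hv w hw hvw
      obtain ⟨q, hq, rfl⟩ := Finset.mem_image.1 hv
      obtain ⟨q', hq', rfl⟩ := Finset.mem_image.1 hw
      rw [hM q hq, hM q' hq'] at hvw
      rw [hinj hq hq' hvw])
  have hid : ∀ q ∈ gridBox p (T + 1), (g (toTorus n q) : ℕ) = L q := fun q hq =>
    (hg _ (Finset.mem_image_of_mem _ hq)).trans (hM q hq)
  obtain ⟨f, hf⟩ := hA (fun v => (g v : ℕ))
    ⟨Subtype.val_injective.comp g.injective, fun v =>
      ⟨(Finset.mem_Icc.1 (g v).2).1, (Finset.mem_Icc.1 (g v).2).2.trans hN⟩⟩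
  refine ⟨f (toTorus n p), f (toTorus n (gridNbr p d)), ?_, ?_, f.valid ⟨?_, d, ?_⟩⟩
  · rw [← hf, A.stateAfter_toTorus T p fun q hq => hid q (gridBox_mono p T.le_succ hq)]
  · rw [← hf, A.stateAfter_toTorus T _ fun q hq => hid q (gridBox_gridNbr_subset p d T hq)]
  · intro h
    have := hproj (Finset.mem_coe.2 <| mem_gridBox.2 (by omega))
      (Finset.mem_coe.2 <| gridBox_gridNbr_subset p d T (mem_gridBox.2 (by omega))) h
    cases d <;> simp only [gridNbr, Prod.ext_iff] at this <;> omega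
  · exact toTorus_gridNbr n p d

end LocalAlgorithm

/-! ### A labelling with two periods -/

/-- The labelling of the infinite grid with horizontal period `a` below the line `y = 0` and `a + 1`
above it, and with vertical period `a` on both sides. The residues of the coordinates are encoded
as digits; the labels below, which are `1, …, a * a`, and those above are disjoint. -/
def twoPeriodLabel (a : ℕ) (p : ℤ × ℤ) : ℕ :=
  if p.2 < 0 then 1 + ((p.1 % a).toNat + a * (p.2 % a).toNat)
  else 1 + a * a + ((p.1 % (a + 1 : ℕ)).toNat + (a + 1) * (p.2 % a).toNat)

theorem toNat_emod_lt {a : ℕ} (ha : 0 < a) (x : ℤ) : (x % a).toNat < a := by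
  have := Int.emod_lt_of_pos x (Int.natCast_pos.2 ha)
  omega

theorem add_mul_lt_mul {a b i j : ℕ} (hi : i < a) (hj : j < b) : i + a * j < a * b := by
  have : a * (j + 1) ≤ a * b := Nat.mul_le_mul_left a hj
  rw [mul_add] at this
  omega

theorem twoPeriodLabel_mem {a n : ℕ} (ha : 0 < a) (h : a * a + (a + 1) * a ≤ n ^ 2) (p : ℤ × ℤ) :
    twoPeriodLabel a p ∈ Finset.Icc 1 (n ^ 2) := by
  have h₁ := add_mul_lt_mul (toNat_emod_lt ha p.1) (toNat_emod_lt ha p.2)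
  have h₂ := add_mul_lt_mul (toNat_emod_lt a.succ_pos p.1) (toNat_emod_lt ha p.2)
  rw [Nat.succ_eq_add_one] at h₂
  rw [Finset.mem_Icc, twoPeriodLabel]
  split_ifs <;> omega

theorem twoPeriodLabel_below {a : ℕ} {p : ℤ × ℤ} (hp : p.2 < 0) :
    twoPeriodLabel a (p.1 + a, p.2) = twoPeriodLabel a p := by
  simp [twoPeriodLabel, hp]

theorem twoPeriodLabel_above {a : ℕ} {p : ℤ × ℤ} (hp : ¬ p.2 < 0) :
    twoPeriodLabel a (p.1 + (a + 1 : ℕ), p.2) = twoPeriodLabel a p := by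
  simp only [twoPeriodLabel, hp, if_false, Int.add_emod_right]

theorem digits_inj {a i j i' j' : ℕ} (hi : i < a) (hi' : i' < a) (h : i + a * j = i' + a * j') :
    i = i' ∧ j = j' := by
  have h₁ := congrArg (· % a) h
  have h₂ := congrArg (· / a) h
  have ha : 0 < a := by omega
  simp only [Nat.add_mul_mod_self_left, Nat.mod_eq_of_lt hi, Nat.mod_eq_of_lt hi'] at h₁
  simp only [Nat.add_mul_div_left _ _ ha, Nat.div_eq_of_lt hi, Nat.div_eq_of_lt hi',
    zero_add] at h₂
  exact ⟨h₁, h₂⟩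

theorem eq_of_toNat_emod_eq {a r : ℕ} (h : 2 * r + 1 ≤ a) {u x y : ℤ}
    (hx : u - r ≤ x ∧ x ≤ u + r) (hy : u - r ≤ y ∧ y ≤ u + r)
    (hxy : (x % a).toNat = (y % a).toNat) : x = y := by
  have ha : (a : ℤ) ≠ 0 := by omega
  have h₁ := Int.emod_nonneg x ha
  have h₂ := Int.emod_nonneg y ha
  have hdvd : (a : ℤ) ∣ x - y := Int.ModEq.dvd (show y % a = x % a by omega)
  have := Int.eq_zero_of_abs_lt_dvd hdvd (by rw [abs_lt]; omega)
  omega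

theorem injOn_twoPeriodLabel {a r : ℕ} (h : 2 * r + 1 ≤ a) (p : ℤ × ℤ) :
    Set.InjOn (twoPeriodLabel a) (gridBox p r) := by
  have ha : 0 < a := by omega
  intro q hq q' hq' hqq
  rw [Finset.mem_coe, mem_gridBox] at hq hq'
  have h₁ := add_mul_lt_mul (toNat_emod_lt ha q.1) (toNat_emod_lt ha q.2)
  have h₂ := add_mul_lt_mul (toNat_emod_lt ha q'.1) (toNat_emod_lt ha q'.2)
  unfold twoPeriodLabel at hqq
  split_ifs at hqq
  · obtain ⟨hi, hj⟩ := digits_inj (toNat_emod_lt ha q.1) (toNat_emod_lt ha q'.1)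
      (Nat.add_left_cancel hqq)
    exact Prod.ext (eq_of_toNat_emod_eq h hq.1 hq'.1 hi) (eq_of_toNat_emod_eq h hq.2 hq'.2 hj)
  · omega
  · omega
  · obtain ⟨hi, hj⟩ := digits_inj (toNat_emod_lt a.succ_pos q.1) (toNat_emod_lt a.succ_pos q'.1)
      (Nat.add_left_cancel hqq)
    exact Prod.ext (eq_of_toNat_emod_eq (h.trans a.le_succ) hq.1 hq'.1 hi)
      (eq_of_toNat_emod_eq h hq.2 hq'.2 hj)

/-! ### The lower bound -/

theorem LocalAlgorithm.not_threeColoursIn {A : LocalAlgorithm.{u, v} (Fin 3)} {n N T : ℕ}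
    (hN : n ^ 2 ≤ N) (hn : 12 * T + 14 ≤ n) : ¬ A.ThreeColoursIn n N T := by
  intro hA
  -- The periods are the coprime numbers `a` and `a + 1`; as `6 ∣ a`, neither `2` nor `3` divides
  -- `a + 1`.
  set a := 6 * T + 6 with ha
  have hsize : a * a + (a + 1) * a ≤ n ^ 2 := by nlinarith
  set L := twoPeriodLabel a
  have hne := fun p d => exists_gridOutput_ne hA hN (by omega) (twoPeriodLabel_mem (by omega) hsize)
    p (injOn_twoPeriodLabel (a := a) (r := T + 1) (by omega) p) d
  have hsome : ∀ p, ∃ c, A.output (A.gridState n L T p) = some c := fun p =>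
    let ⟨c, _, hc, _⟩ := hne p .north
    ⟨c, hc⟩
  choose col hcol using hsome
  have hcol_ne : ∀ p d, col p ≠ col (gridNbr p d) := by
    intro p d
    obtain ⟨c, c', h, h', hcc⟩ := hne p d
    rw [hcol, Option.some_inj] at h h'
    rwa [h, h']
  have hper : ∀ (b : ℤ) (p : ℤ × ℤ), (∀ q ∈ gridBox p T, L (q.1 + b, q.2) = L q) →
      col (p.1 + b, p.2) = col p := by
    intro b p h
    rw [← Option.some_inj, ← hcol, ← hcol, A.gridState_translate n b T p h]
  -- The row `-(T + 1)` sees only labels below the line `y = 0`, the row `T` only labels above it.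
  refine false_of_proper_of_periodic_rows (col := fun y x => col (x, y))
    (fun y x => hcol_ne (x, y) .east) (fun y x => hcol_ne (x, y) .north) (a := a) (b := a + 1)
    (by simp) (by omega) (by omega) (-(T + 1 : ℕ)) (2 * T + 1)
    (fun x => hper a (x, _) fun q hq => twoPeriodLabel_below ?_)
    (fun x => hper (a + 1 : ℕ) (x, _) fun q hq => twoPeriodLabel_above ?_)
  all_goals
    rw [mem_gridBox] at hq
    push_cast at hq
    omega

theorem theorem8p1 :
    ∃ c : ℝ, 0 < c ∧ ∃ n₀ : ℕ, ∀ n : ℕ, n₀ ≤ n →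
      ∀ N : ℕ, n ^ 2 ≤ N → ∀ (A : LocalAlgorithm.{u, v} (Fin 3)) (T : ℕ),
        A.ThreeColoursIn n N T → c * (n : ℝ) ≤ (T : ℝ) := by
  refine ⟨1 / 24, by norm_num, 28, fun n hn N hN A T hA => ?_⟩
  by_contra! h
  have h' : 24 * T < n := by
    have : (24 : ℝ) * T < n := by linarith
    exact_mod_cast this
  exact LocalAlgorithm.not_threeColoursIn hN (by omega) hA
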